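/- Let $n\ge 1$ be an integer and let $W:\mathbb R\to[0,\infty)$ be a $C^2$ function such that: (i) $W(t)=W(-t)$ for all $t\in\mathbb R$; (ii) $\min W=0$ and $\{t: W(t)=0\}=\{-1,1\}$; (iii) $W''(1)>0$; (iv) $W$ is strictly decreasing on $[0,1]$ and strictly increasing for $t>1$. For $\varepsilon>0$ put $W_\varepsilon=\varepsilon^{-2}W$, $f_\varepsilon=-W_\varepsilon'$, and, for $h\in C^2(\mathbb R)$, $$E_\varepsilon(h)=\int_{\mathbb R}\Big(\tfrac12 h'(\tau)^2+W_\varepsilon(h(\tau))\Big)\cosh^{n-1}\tau\,d\tau\in[0,\infty].$$ Then for every $\varepsilon>0$ the problem $$h''(\tau)+(n-1)\tanh\tau\,h'(\tau)=-f_\varepsilon(h(\tau))\quad(\tau\in\mathbb R),\qquad \lim_{\tau\to\pm\infty}h(\tau)=\pm1,$$ has a solution $h_\varepsilon\in C^2(\mathbb R)$ which is odd and strictly increasing, and these solutions can be chosen so that the following holds. For every $\varepsilon_0>0$ there is a constant $C>0$, independent of $\varepsilon$, such that $E_\varepsilon(h_\varepsilon)\le C/\varepsilon$ for all $0<\varepsilon\le\varepsilon_0$.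 Moreover, $h_\varepsilon(\tau)\to\operatorname{sgn}(\tau)$ locally uniformly in $\mathbb R\setminus\{0\}$ as $\varepsilon\to0^+$. -/

import Mathlib

open Filter Topology MeasureTheory
open scoped ENNReal

/-- The assumptions on the double-well potential `W : ℝ → [0, ∞)`, a function of class `C²`. -/
structure IsDoubleWell (W : ℝ → ℝ) : Prop where
  contDiff : ContDiff ℝ 2 W
  nonneg : ∀ t, 0 ≤ W t
  even : ∀ t, W t = W (-t)
  /-- together with `nonneg`, this says that `min W = 0` and it is attained exactly at `±1` -/
  zero_iff : ∀ t, W t = 0 ↔ t = -1 ∨ t = 1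
  second_deriv_pos : 0 < deriv (deriv W) 1
  strictAntiOn : StrictAntiOn W (Set.Icc 0 1)
  strictMonoOn : StrictMonoOn W (Set.Ioi 1)

/-- The rescaled potential `W_ε = W / ε²`. -/
noncomputable def scaledPotential (W : ℝ → ℝ) (ε : ℝ) : ℝ → ℝ :=
  fun t => 1 / ε ^ 2 * W t

/-- The nonlinearity `f_ε = - W_ε'`. -/
noncomputable def nonlinearity (W : ℝ → ℝ) (ε : ℝ) : ℝ → ℝ :=
  fun t => - deriv (scaledPotential W ε) t

/-- `h` is a (classical, `C²`) solution on the whole line of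
`h'' + (n - 1) tanh τ h' = - f_ε(h)` with `h(±∞) = ±1`. -/
structure IsProfile (n : ℕ) (W : ℝ → ℝ) (ε : ℝ) (h : ℝ → ℝ) : Prop where
  contDiff : ContDiff ℝ 2 h
  ode : ∀ τ : ℝ, deriv (deriv h) τ + ((n : ℝ) - 1) * Real.tanh τ * deriv h τ =
    - nonlinearity W ε (h τ)
  tendsto_atTop : Tendsto h atTop (𝓝 1)
  tendsto_atBot : Tendsto h atBot (𝓝 (-1))

/-- The weighted energy `E_ε(h) = ∫ (h'² / 2 + W_ε(h)) cosh^(n-1) τ dτ` over the line, with values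
in `[0, ∞]` (for `W ≥ 0` the integrand is nonnegative), so that a finite bound on it includes the
finiteness of the energy. -/
noncomputable def profileEnergy (n : ℕ) (W : ℝ → ℝ) (ε : ℝ) (h : ℝ → ℝ) : ℝ≥0∞ :=
  ∫⁻ τ : ℝ, ENNReal.ofReal
    ((1 / 2 * (deriv h τ) ^ 2 + scaledPotential W ε (h τ)) * Real.cosh τ ^ (n - 1))

/-! Put `V = W/ε²` and `N = n - 1`. The profile comes from shooting: solve `h'' + N tanh τ h' =
V'(h)` with `h 0 = 0`, `h' 0 = s`, where `V'` is frozen outside `[-1, 1]`. As `V'(±1) = 0`, the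
frozen force is bounded, Lipschitz and vanishes there, so shots are global and depend continuously
on `s`. The energy `h'²/2 - V(h)` (with `V` truncated to match) decreases for `τ ≥ 0`. Slopes whose
shot exceeds `1`, and slopes whose energy becomes negative, form disjoint open sets, both meeting
`[0, ∞)`; by connectedness some slope lies in neither. Its shot stays below `1` with nonnegative
energy, hence never stops increasing: it is the kink (`exists_isKink`).

The estimates rest on `V(h) ≤ h'²/2` for `τ ≥ 0`. It forces `h' ≥ √(2 V(c))` while `0 ≤ h ≤ c`, so
`h` passes `c < 1` by time `1/√(2 V(c))`, which is `O(ε)`; this gives both the limits at infinity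
and the convergence to the sign (`lt_of_one_lt_mul`). It also bounds the energy density by `h'²`. On
`[0, 1]`, `h'² ≤ h'(0) h'`, and `h'(0) = O(1/ε)`; beyond `1`, an identity for the weighted energy
bounds the tail independently of `ε`, despite the growing weight. -/

/-! ### Global solvability and continuous dependence for the damped equation. -/

theorem exists_hasDerivAt_of_forall_Ioo {E : Type*} [NormedAddCommGroup E] [NormedSpace ℝ E]
    {v : ℝ → E → E} {K : NNReal} (hv : ∀ t, LipschitzWith K (v t)) (x₀ : E)
    (hloc : ∀ T : ℝ, 0 < T → ∃ α : ℝ → E, α 0 = x₀ ∧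
      ∀ t ∈ Set.Ioo (-T) T, HasDerivAt α (v t (α t)) t) :
    ∃ α : ℝ → E, α 0 = x₀ ∧ ∀ t, HasDerivAt α (v t (α t)) t := by
  choose! α hα0 hα using hloc
  have huniq : ∀ S T : ℝ, 0 < S → S ≤ T → Set.EqOn (α S) (α T) (Set.Ioo (-S) S) := by
    intro S T hS hST
    refine ODE_solution_unique_of_mem_Ioo (v := v) (K := K) (s := fun _ => Set.univ) (t₀ := 0)
      (fun t _ => (hv t).lipschitzOnWith) ⟨by linarith, hS⟩
      (fun t ht => ⟨hα S hS t ht, trivial⟩)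
      (fun t ht => ⟨hα T (by linarith) t ⟨by linarith [ht.1], by linarith [ht.2]⟩, trivial⟩) ?_
    rw [hα0 S hS, hα0 T (by linarith)]
  have key : ∀ T : ℝ, 0 < T → ∀ t ∈ Set.Ioo (-T) T, α (|t| + 1) t = α T t := by
    intro T hT t ht
    have h1 : 0 < |t| + 1 := by positivity
    have ht1 : |t| < T := abs_lt.2 ht
    rcases le_total (|t| + 1) T with h | h
    · exact huniq _ _ h1 h (abs_lt.1 (by linarith))
    · exact (huniq _ _ hT h ht).symm
  -- By uniqueness, the value at `t` is the same from every interval containing `t`; the radius `|t|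
  -- + 1` is one choice.
  refine ⟨fun t => α (|t| + 1) t, by simpa using hα0 1 one_pos, fun t => ?_⟩
  have hT : 0 < |t| + 1 := by positivity
  have ht : t ∈ Set.Ioo (-(|t| + 1)) (|t| + 1) := abs_lt.1 (by linarith)
  refine (hα _ hT t ht).congr_of_eventuallyEq ?_
  filter_upwards [Ioo_mem_nhds ht.1 ht.2] with u hu using key _ hT u hu

/-- The first order system in `(h, h')` of the equation `h'' + N tanh τ h' = g(h)`. -/
noncomputable def dampedField (N : ℕ) (g : ℝ → ℝ) (t : ℝ) (x : ℝ × ℝ) : ℝ × ℝ :=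
  (x.2, g x.1 - N * Real.tanh t * x.2)

theorem abs_tanh_le_one (t : ℝ) : |Real.tanh t| ≤ 1 :=
  abs_le.2 ⟨(Real.neg_one_lt_tanh t).le, (Real.tanh_lt_one t).le⟩

theorem lipschitzWith_dampedField {N : ℕ} {g : ℝ → ℝ} {L : NNReal} (hg : LipschitzWith L g)
    (t : ℝ) : LipschitzWith (1 + L + N) (dampedField N g t) := by
  refine LipschitzWith.of_dist_le_mul fun x y => ?_
  have h1 : |x.1 - y.1| ≤ dist x y := by
    rw [Prod.dist_eq, ← Real.dist_eq]; exact le_max_left _ _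
  have h2 : |x.2 - y.2| ≤ dist x y := by
    rw [Prod.dist_eq, ← Real.dist_eq]; exact le_max_right _ _
  have h3 : |g x.1 - g y.1| ≤ L * |x.1 - y.1| := by simpa [Real.dist_eq] using hg.dist_le_mul x.1 y.1
  have h0 : 0 ≤ dist x y := dist_nonneg
  rw [Prod.dist_eq (x := dampedField N g t x)]
  simp only [dampedField, Real.dist_eq, NNReal.coe_add, NNReal.coe_one, NNReal.coe_natCast]
  have hL : (L : ℝ) * |x.1 - y.1| ≤ L * dist x y := by gcongr
  have hN : (N : ℝ) * |x.2 - y.2| ≤ N * dist x y := by gcongr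
  have hN0 : 0 ≤ (N : ℝ) * dist x y := by positivity
  have hL0 : 0 ≤ (L : ℝ) * dist x y := by positivity
  apply max_le
  · nlinarith
  · have : g x.1 - N * Real.tanh t * x.2 - (g y.1 - N * Real.tanh t * y.2)
        = (g x.1 - g y.1) - N * (Real.tanh t * (x.2 - y.2)) := by ring
    rw [this]
    have h4 : |(N : ℝ) * (Real.tanh t * (x.2 - y.2))| ≤ N * |x.2 - y.2| := by
      rw [abs_mul, abs_mul, Nat.abs_cast]
      have := mul_le_mul_of_nonneg_right (abs_tanh_le_one t) (abs_nonneg (x.2 - y.2))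
      gcongr
      linarith
    have := abs_sub (g x.1 - g y.1) (N * (Real.tanh t * (x.2 - y.2)))
    linarith

theorem hasDerivAt_cosh_pow (N : ℕ) (t : ℝ) :
    HasDerivAt (fun t => Real.cosh t ^ N) (N * Real.tanh t * Real.cosh t ^ N) t := by
  refine ((Real.hasDerivAt_cosh t).pow N).congr_deriv ?_
  rw [Real.tanh_eq_sinh_div_cosh]
  have := (Real.cosh_pos t).ne'
  rcases N with _ | N
  · simp
  · field_simp
    simp only [Nat.add_sub_cancel, pow_succ]
    ring

theorem cosh_pow_le_of_mem {N : ℕ} {T t : ℝ} (ht : t ∈ Set.Icc (-T) T) :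
    Real.cosh t ^ N ≤ Real.cosh T ^ N := by
  have h : |t| ≤ T := abs_le.2 ht
  exact pow_le_pow_left₀ (Real.cosh_pos t).le
    (Real.cosh_le_cosh.2 (h.trans (le_abs_self T))) N

theorem lipschitzWith_clamp (a b : ℝ) : LipschitzWith 1 (fun t : ℝ => max a (min b t)) :=
  (LipschitzWith.id.const_min b).const_max a

/-- In the variables `(h, q)` with `q = cosh^N h'` the damping disappears: `h' = q / cosh^N`, `q' =
cosh^N g(h)`. Since `g` is bounded, `|q| ≤ R` on `[-T, T]` a priori. Clamping `q` at `R` makes the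
field bounded, so Picard–Lindelöf covers the whole interval at once, and the clamp is never active.
-/
theorem exists_Ioo_hasDerivAt_dampedField (N : ℕ) {g : ℝ → ℝ} {L : NNReal}
    (hg : LipschitzWith L g) {M : ℝ} (hM : ∀ t, |g t| ≤ M) (s T : ℝ) (hT : 0 < T) :
    ∃ α : ℝ → ℝ × ℝ, α 0 = (0, s) ∧
      ∀ t ∈ Set.Ioo (-T) T, HasDerivAt α (dampedField N g t (α t)) t := by
  have hM0 : 0 ≤ M := (abs_nonneg _).trans (hM 0)
  set P := Real.cosh T ^ N with hP
  have hP0 : 0 < P := pow_pos (Real.cosh_pos T) N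
  set R := |s| + P * M * T with hR
  have hR0 : 0 ≤ R := by positivity
  set c : ℝ → ℝ := fun t => max (-R) (min R t) with hc
  have hcR : ∀ t, |c t| ≤ R := fun t =>
    abs_le.2 ⟨le_max_left _ _, max_le (by linarith) (min_le_left _ _)⟩
  have hcid : ∀ t, |t| ≤ R → c t = t := fun t ht => by
    rw [abs_le] at ht
    simp only [hc]
    rw [min_eq_right ht.2, max_eq_right ht.1]
  set p : ℝ → ℝ := fun t => Real.cosh t ^ N with hp
  have hp1 : ∀ t, 1 ≤ p t := fun t => one_le_pow₀ (Real.one_le_cosh t)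
  have hp0 : ∀ t, 0 < p t := fun t => pow_pos (Real.cosh_pos t) N
  have hpcont : Continuous p := Real.continuous_cosh.pow N
  set f : ℝ → ℝ × ℝ → ℝ × ℝ := fun t x => (c x.2 / p t, p t * g x.1) with hf
  have h0 : (0 : ℝ) ∈ Set.Icc (-T) T := ⟨by linarith, hT.le⟩
  obtain ⟨A, hA⟩ : ∃ A : NNReal, (A : ℝ) = R + P * M := ⟨⟨R + P * M, by positivity⟩, rfl⟩
  obtain ⟨P', hP'⟩ : ∃ P' : NNReal, (P' : ℝ) = P := ⟨⟨P, hP0.le⟩, rfl⟩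
  obtain ⟨T', hT'⟩ : ∃ T' : NNReal, (T' : ℝ) = T := ⟨⟨T, hT.le⟩, rfl⟩
  have hPL : IsPicardLindelof f (⟨0, h0⟩ : Set.Icc (-T) T) ((0, s) : ℝ × ℝ)
      (A * T') 0 A (1 + P' * L) := by
    refine ⟨fun t ht => (LipschitzWith.of_dist_le_mul fun x y => ?_).lipschitzOnWith,
      fun x _ => ?_, fun t ht x _ => ?_, ?_⟩
    · have h1 : |x.1 - y.1| ≤ dist x y := by
        rw [Prod.dist_eq, ← Real.dist_eq]; exact le_max_left _ _
      have h2 : |x.2 - y.2| ≤ dist x y := by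
        rw [Prod.dist_eq, ← Real.dist_eq]; exact le_max_right _ _
      have h3 : |g x.1 - g y.1| ≤ L * |x.1 - y.1| := by
        simpa [Real.dist_eq] using hg.dist_le_mul x.1 y.1
      have h4 : |c x.2 - c y.2| ≤ |x.2 - y.2| := by
        simpa [Real.dist_eq] using (lipschitzWith_clamp (-R) R).dist_le_mul x.2 y.2
      have hd : 0 ≤ dist x y := dist_nonneg
      rw [Prod.dist_eq (x := f t x)]
      simp only [hf, Real.dist_eq, NNReal.coe_add, NNReal.coe_one, NNReal.coe_mul, hP']
      have hPL0 : 0 ≤ P * L * dist x y := by positivity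
      apply max_le
      · rw [← sub_div, abs_div, abs_of_pos (hp0 t)]
        have := div_le_self (abs_nonneg (c x.2 - c y.2)) (hp1 t)
        linarith
      · rw [← mul_sub, abs_mul, abs_of_pos (hp0 t)]
        have : p t * |g x.1 - g y.1| ≤ P * (L * dist x y) := by
          have := cosh_pow_le_of_mem (N := N) ht
          gcongr
          exact h3.trans (by gcongr)
        linarith
    · exact ((continuous_const.div hpcont fun t => (hp0 t).ne').prodMk
        (hpcont.mul continuous_const)).continuousOn
    · have hPM : 0 ≤ P * M := by positivity
      rw [Prod.norm_def]
      simp only [hf, hA, Real.norm_eq_abs]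
      apply max_le
      · rw [abs_div, abs_of_pos (hp0 t)]
        have := div_le_self (abs_nonneg (c x.2)) (hp1 t)
        linarith [hcR x.2]
      · rw [abs_mul, abs_of_pos (hp0 t)]
        have : p t * |g x.1| ≤ P * M :=
          mul_le_mul (cosh_pow_le_of_mem (N := N) ht) (hM _) (abs_nonneg _) hP0.le
        linarith
    · simp [hT']
  obtain ⟨β, hβ0, hβ⟩ := hPL.exists_eq_forall_mem_Icc_hasDerivWithinAt₀
  have hβ1 : ∀ t ∈ Set.Icc (-T) T,
      HasDerivWithinAt (fun t => (β t).1) (c (β t).2 / p t) (Set.Icc (-T) T) t :=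
    fun t ht => (hβ t ht).fst
  have hβ2 : ∀ t ∈ Set.Icc (-T) T,
      HasDerivWithinAt (fun t => (β t).2) (p t * g (β t).1) (Set.Icc (-T) T) t :=
    fun t ht => (hβ t ht).snd
  have hβ0' : β 0 = (0, s) := hβ0
  have hbd : ∀ t ∈ Set.Icc (-T) T, |(β t).2| ≤ R := by
    intro t ht
    have := (convex_Icc (-T) T).norm_image_sub_le_of_norm_hasDerivWithin_le (C := P * M) hβ2
      (fun u hu => by
        rw [Real.norm_eq_abs, abs_mul, abs_of_pos (hp0 u)]
        exact mul_le_mul (cosh_pow_le_of_mem (N := N) hu) (hM _) (abs_nonneg _) hP0.le) h0 ht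
    simp only [hβ0', Real.norm_eq_abs, sub_zero] at this
    have htT : |t| ≤ T := abs_le.2 ht
    have h5 : P * M * |t| ≤ P * M * T := by gcongr
    have h6 := abs_sub_abs_le_abs_sub (β t).2 s
    simp only [hR]
    linarith
  refine ⟨fun t => ((β t).1, (β t).2 / p t), by simp [hβ0', hp], fun t ht => ?_⟩
  have htI := Set.Ioo_subset_Icc_self ht
  have hn : Set.Icc (-T) T ∈ 𝓝 t := Icc_mem_nhds ht.1 ht.2
  have d1 := (hβ1 t htI).hasDerivAt hn
  have d2 := ((hβ2 t htI).hasDerivAt hn).div (hasDerivAt_cosh_pow N t) (hp0 t).ne'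
  rw [hcid _ (hbd t htI)] at d1
  refine (d1.prodMk d2).congr_deriv ?_
  simp only [dampedField, Prod.mk.injEq, true_and]
  have := (hp0 t).ne'
  simp only [hp] at this ⊢
  field_simp

/-- `h` solves `h'' + N tanh τ h' = g(h)` with derivative `k`, `h(0) = 0` and `k(0) = s`. -/
structure IsShot (N : ℕ) (g : ℝ → ℝ) (s : ℝ) (h k : ℝ → ℝ) : Prop where
  init : h 0 = 0
  init_deriv : k 0 = s
  hasDerivAt : ∀ t, HasDerivAt h (k t) t
  hasDerivAt_deriv : ∀ t, HasDerivAt k (g (h t) - N * Real.tanh t * k t) t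

theorem exists_isShot (N : ℕ) {g : ℝ → ℝ} {L : NNReal}
    (hg : LipschitzWith L g) {M : ℝ} (hM : ∀ t, |g t| ≤ M) (s : ℝ) :
    ∃ h k, IsShot N g s h k := by
  obtain ⟨α, h0, hα⟩ := exists_hasDerivAt_of_forall_Ioo (lipschitzWith_dampedField (N := N) hg)
    (0, s) (exists_Ioo_hasDerivAt_dampedField N hg hM s)
  exact ⟨fun t => (α t).1, fun t => (α t).2, by simp [h0], by simp [h0],
    fun t => (hα t).fst, fun t => (hα t).snd⟩

theorem damped_unique {N : ℕ} {g : ℝ → ℝ} {L : NNReal} (hg : LipschitzWith L g)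
    {h₁ k₁ h₂ k₂ : ℝ → ℝ} (d₁ : ∀ t, HasDerivAt h₁ (k₁ t) t)
    (d₁' : ∀ t, HasDerivAt k₁ (g (h₁ t) - N * Real.tanh t * k₁ t) t)
    (d₂ : ∀ t, HasDerivAt h₂ (k₂ t) t)
    (d₂' : ∀ t, HasDerivAt k₂ (g (h₂ t) - N * Real.tanh t * k₂ t) t) {t₀ : ℝ}
    (hh : h₁ t₀ = h₂ t₀) (hk : k₁ t₀ = k₂ t₀) : h₁ = h₂ := by
  have := ODE_solution_unique_univ (v := dampedField N g) (K := 1 + L + N)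
    (s := fun _ => Set.univ) (f := fun t => (h₁ t, k₁ t)) (g := fun t => (h₂ t, k₂ t)) (t₀ := t₀)
    (fun t => (lipschitzWith_dampedField hg t).lipschitzOnWith)
    (fun t => ⟨(d₁ t).prodMk (d₁' t), trivial⟩) (fun t => ⟨(d₂ t).prodMk (d₂' t), trivial⟩)
    (by simp [hh, hk])
  funext t
  exact congrArg Prod.fst (congrFun this t)

theorem continuous_shots {N : ℕ} {g : ℝ → ℝ} {L : NNReal} (hg : LipschitzWith L g)
    {h k : ℝ → ℝ → ℝ} (H : ∀ s, IsShot N g s (h s) (k s)) {t : ℝ} (ht : 0 ≤ t) :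
    Continuous (fun s => h s t) ∧ Continuous (fun s => k s t) := by
  have : LipschitzWith (Real.exp ((1 + L + N : NNReal) * t)).toNNReal
      (fun s => (h s t, k s t)) := by
    refine LipschitzWith.of_dist_le_mul fun s s' => ?_
    have hd : ∀ s u, HasDerivAt (fun t => (h s t, k s t))
        (dampedField N g u (h s u, k s u)) u := fun s u =>
      ((H s).hasDerivAt u).prodMk ((H s).hasDerivAt_deriv u)
    have := dist_le_of_trajectories_ODE (v := dampedField N g) (K := 1 + L + N) (a := 0) (b := t)
      (δ := dist s s') (lipschitzWith_dampedField hg)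
      (HasDerivAt.continuousOn fun u _ => hd s u) (fun u _ => (hd s u).hasDerivWithinAt)
      (HasDerivAt.continuousOn fun u _ => hd s' u) (fun u _ => (hd s' u).hasDerivWithinAt)
      (by simp [Prod.dist_eq, (H s).init, (H s').init, (H s).init_deriv, (H s').init_deriv])
      t ⟨ht, le_rfl⟩
    rw [Real.coe_toNNReal _ (Real.exp_pos _).le, mul_comm]
    simpa using this
  exact ⟨continuous_fst.comp this.continuous, continuous_snd.comp this.continuous⟩

/-! ### The double well and its truncation outside `[-1, 1]`. -/

namespace IsDoubleWell

variable {V : ℝ → ℝ}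

theorem differentiable (hV : IsDoubleWell V) : Differentiable ℝ V :=
  hV.contDiff.differentiable (by norm_num)

theorem contDiff_deriv (hV : IsDoubleWell V) : ContDiff ℝ 1 (deriv V) :=
  ((contDiff_succ_iff_deriv (n := 1) (f := V)).1 hV.contDiff).2.2

theorem continuous_deriv (hV : IsDoubleWell V) : Continuous (deriv V) :=
  hV.contDiff_deriv.continuous

theorem deriv_neg (hV : IsDoubleWell V) (t : ℝ) : deriv V (-t) = - deriv V t := by
  have h : V = fun t => V (-t) := funext hV.even
  have h2 := deriv_comp_neg V t
  rw [← h] at h2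
  linarith

theorem deriv_one (hV : IsDoubleWell V) : deriv V 1 = 0 := by
  refine IsLocalMin.deriv_eq_zero (Eventually.of_forall fun t => ?_)
  rw [(hV.zero_iff 1).2 (Or.inr rfl)]
  exact hV.nonneg t

theorem deriv_nonpos (hV : IsDoubleWell V) {t : ℝ} (ht : t ∈ Set.Icc (0 : ℝ) 1) :
    deriv V t ≤ 0 := by
  have hcl : IsClosed {t | deriv V t ≤ 0} := isClosed_le hV.continuous_deriv continuous_const
  have hsub : Set.Ioo (0 : ℝ) 1 ⊆ {t | deriv V t ≤ 0} := fun u hu => by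
    have h := hV.strictAntiOn.antitoneOn.derivWithin_nonpos (x := u)
    rwa [(hV.differentiable u).derivWithin (uniqueDiffOn_Icc one_pos u
      (Set.Ioo_subset_Icc_self hu))] at h
  have := closure_minimal hsub hcl
  rw [closure_Ioo zero_ne_one] at this
  exact this ht

theorem pos_of_abs_lt (hV : IsDoubleWell V) {t : ℝ} (ht : |t| < 1) : 0 < V t := by
  refine lt_of_le_of_ne (hV.nonneg t) fun h => ?_
  rcases (hV.zero_iff t).1 h.symm with rfl | rfl <;> simp at ht

end IsDoubleWell

/-- The derivative of the potential, frozen outside `[-1, 1]`. -/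
noncomputable def clampedForce (V : ℝ → ℝ) (t : ℝ) : ℝ := deriv V (max (-1) (min 1 t))

theorem clampedForce_of_mem {V : ℝ → ℝ} {t : ℝ} (ht : t ∈ Set.Icc (-1 : ℝ) 1) :
    clampedForce V t = deriv V t := by
  rw [clampedForce, min_eq_right ht.2, max_eq_right ht.1]

theorem clamp_mem_Icc (t : ℝ) : max (-1) (min 1 t) ∈ Set.Icc (-1 : ℝ) 1 :=
  ⟨le_max_left _ _, max_le (by norm_num) (min_le_left _ _)⟩

namespace IsDoubleWell

variable {V : ℝ → ℝ}

theorem exists_lipschitzWith_clampedForce (hV : IsDoubleWell V) :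
    ∃ L : NNReal, LipschitzWith L (clampedForce V) := by
  obtain ⟨C, hC⟩ := isCompact_Icc.exists_bound_of_continuousOn (s := Set.Icc (-1 : ℝ) 1)
    (hV.contDiff_deriv.continuous_deriv le_rfl).continuousOn
  have hlip := (convex_Icc (-1 : ℝ) 1).lipschitzOnWith_of_nnnorm_deriv_le
    (f := deriv V) (C := C.toNNReal)
    (fun x _ => hV.contDiff_deriv.differentiable (by norm_num) x)
    (fun x hx => by
      rw [← NNReal.coe_le_coe, coe_nnnorm]
      exact (hC x hx).trans (Real.le_coe_toNNReal C))
  refine ⟨C.toNNReal, LipschitzWith.of_dist_le_mul fun x y => ?_⟩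
  refine (hlip.dist_le_mul _ (clamp_mem_Icc x) _ (clamp_mem_Icc y)).trans ?_
  gcongr
  simpa using (lipschitzWith_clamp (-1) 1).dist_le_mul x y

theorem exists_abs_deriv_le (hV : IsDoubleWell V) :
    ∃ M : ℝ, ∀ t ∈ Set.Icc (-1 : ℝ) 1, |deriv V t| ≤ M :=
  isCompact_Icc.exists_bound_of_continuousOn hV.continuous_deriv.continuousOn

theorem continuous_clampedForce (hV : IsDoubleWell V) : Continuous (clampedForce V) :=
  hV.continuous_deriv.comp (by fun_prop)

theorem clampedForce_neg (hV : IsDoubleWell V) (t : ℝ) :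
    clampedForce V (-t) = - clampedForce V t := by
  rw [clampedForce, clampedForce, ← hV.deriv_neg, ← min_neg_neg, ← max_neg_neg, neg_neg]
  congr 1
  rcases le_total t 1 with h | h <;> rcases le_total (-1) t with h' | h' <;> grind

theorem clampedForce_of_one_le (hV : IsDoubleWell V) {t : ℝ} (ht : 1 ≤ t) :
    clampedForce V t = 0 := by
  rw [clampedForce, min_eq_left ht, max_eq_right (by norm_num), hV.deriv_one]

theorem clampedForce_of_le_neg_one (hV : IsDoubleWell V) {t : ℝ} (ht : t ≤ -1) :
    clampedForce V t = 0 := by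
  rw [← neg_neg t, hV.clampedForce_neg, hV.clampedForce_of_one_le (by linarith), neg_zero]

end IsDoubleWell

/-- The potential, replaced by `0` outside `[-1, 1]`. -/
noncomputable def clampedPotential (V : ℝ → ℝ) (t : ℝ) : ℝ :=
  V 0 + ∫ x in (0 : ℝ)..t, clampedForce V x

namespace IsDoubleWell

variable {V : ℝ → ℝ}

theorem hasDerivAt_clampedPotential (hV : IsDoubleWell V) (t : ℝ) :
    HasDerivAt (clampedPotential V) (clampedForce V t) t :=
  (hV.continuous_clampedForce.integral_hasStrictDerivAt 0 t).hasDerivAt.const_add _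

theorem clampedPotential_of_mem (hV : IsDoubleWell V) {t : ℝ} (ht : t ∈ Set.Icc (-1 : ℝ) 1) :
    clampedPotential V t = V t := by
  rw [clampedPotential, intervalIntegral.integral_eq_sub_of_hasDerivAt (f := V)]
  · ring
  · intro x hx
    have hx' : x ∈ Set.Icc (-1 : ℝ) 1 :=
      Set.uIcc_subset_Icc (by norm_num) ht hx
    rw [clampedForce_of_mem hx']
    exact (hV.differentiable x).hasDerivAt
  · exact hV.continuous_clampedForce.intervalIntegrable _ _

theorem clampedPotential_of_one_le_abs (hV : IsDoubleWell V) {t : ℝ} (ht : 1 ≤ |t|) :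
    clampedPotential V t = 0 := by
  have hd : Differentiable ℝ (clampedPotential V) := fun t =>
    (hV.hasDerivAt_clampedPotential t).differentiableAt
  rcases le_abs.1 ht with h | h
  · have h1 : clampedPotential V 1 = 0 := by
      rw [hV.clampedPotential_of_mem (by norm_num), (hV.zero_iff 1).2 (Or.inr rfl)]
    rw [← h1]
    refine (convex_Ici (1 : ℝ)).is_const_of_fderivWithin_eq_zero (𝕜 := ℝ)
      hd.differentiableOn (fun x hx => ?_) h (le_refl (1 : ℝ))
    rw [((hV.hasDerivAt_clampedPotential x).hasFDerivAt.hasFDerivWithinAt).fderivWithin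
      (uniqueDiffOn_Ici 1 x hx), hV.clampedForce_of_one_le hx]
    ext; simp
  · have h1 : clampedPotential V (-1) = 0 := by
      rw [hV.clampedPotential_of_mem (by norm_num), (hV.zero_iff (-1)).2 (Or.inl rfl)]
    rw [← h1]
    refine (convex_Iic (-1 : ℝ)).is_const_of_fderivWithin_eq_zero (𝕜 := ℝ)
      hd.differentiableOn (fun x hx => ?_) (show t ≤ -1 by linarith) (le_refl (-1 : ℝ))
    rw [((hV.hasDerivAt_clampedPotential x).hasFDerivAt.hasFDerivWithinAt).fderivWithin
      (uniqueDiffOn_Iic (-1) x hx), hV.clampedForce_of_le_neg_one hx]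
    ext; simp

end IsDoubleWell

/-! ### Shooting for the kink. -/

namespace IsShot

variable {N : ℕ} {g h k : ℝ → ℝ} {s : ℝ}

theorem continuous (H : IsShot N g s h k) : Continuous h :=
  continuous_iff_continuousAt.2 fun t => (H.hasDerivAt t).continuousAt

theorem continuous_deriv (H : IsShot N g s h k) : Continuous k :=
  continuous_iff_continuousAt.2 fun t => (H.hasDerivAt_deriv t).continuousAt

theorem odd (H : IsShot N g s h k) {L : NNReal} (hg : LipschitzWith L g)
    (hodd : ∀ t, g (-t) = - g t) : Function.Odd h := by
  have := damped_unique (N := N) hg H.hasDerivAt H.hasDerivAt_deriv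
    (h₂ := fun t => -h (-t)) (k₂ := fun t => k (-t)) (t₀ := 0)
    (fun t => by
      refine ((H.hasDerivAt (-t)).comp t (hasDerivAt_neg t)).neg.congr_deriv ?_
      ring)
    (fun t => by
      refine ((H.hasDerivAt_deriv (-t)).comp t (hasDerivAt_neg t)).congr_deriv ?_
      rw [hodd, Real.tanh_neg]; ring) (by simp [H.init]) (by simp)
  intro t
  have h1 := congrFun this (-t)
  simpa using h1

theorem deriv_even (H : IsShot N g s h k) (hodd : Function.Odd h) (t : ℝ) : k (-t) = k t := by
  have h1 := ((H.hasDerivAt (-t)).comp t (hasDerivAt_neg t)).neg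
  have h2 : (-(h ∘ Neg.neg)) = h := by
    funext u; simp [hodd u]
  rw [h2] at h1
  simpa using h1.unique (H.hasDerivAt t)

end IsShot

theorem tanh_nonneg {t : ℝ} (ht : 0 ≤ t) : 0 ≤ Real.tanh t := by
  rw [Real.tanh_eq_sinh_div_cosh]
  exact div_nonneg (Real.sinh_nonneg_iff.2 ht) (Real.cosh_pos t).le

/-- Damping dissipates: the derivative is `-N tanh t k²`. -/
theorem energy_antitoneOn {N : ℕ} {g G h k : ℝ → ℝ} (hh : ∀ t, HasDerivAt h (k t) t)
    (hk : ∀ t, HasDerivAt k (g (h t) - N * Real.tanh t * k t) t)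
    (hG : ∀ t, HasDerivAt G (g t) t) :
    AntitoneOn (fun t => k t ^ 2 / 2 - G (h t)) (Set.Ici 0) := by
  have hd : ∀ t, HasDerivAt (fun t => k t ^ 2 / 2 - G (h t))
      (-(N * Real.tanh t * k t ^ 2)) t := fun t => by
    refine ((((hk t).pow 2).div_const 2).sub ((hG (h t)).comp t (hh t))).congr_deriv ?_
    push_cast; ring
  refine antitoneOn_of_deriv_nonpos (convex_Ici 0)
    (fun t _ => (hd t).continuousAt.continuousWithinAt)
    (fun t _ => (hd t).differentiableAt.differentiableWithinAt) fun t ht => ?_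
  rw [interior_Ici] at ht
  rw [(hd t).deriv]
  have : 0 ≤ Real.tanh t := tanh_nonneg (le_of_lt ht)
  have : 0 ≤ N * Real.tanh t * k t ^ 2 := by positivity
  linarith

/-- An increasing odd solution of `h'' + N tanh τ h' = V'(h)` joining `-1` to `1`, together with
its derivative `k`, in the form in which the shooting method produces it. -/
structure IsKink (N : ℕ) (V h k : ℝ → ℝ) : Prop where
  odd : Function.Odd h
  hasDerivAt : ∀ t, HasDerivAt h (k t) t
  hasDerivAt_deriv : ∀ t, HasDerivAt k (deriv V (h t) - N * Real.tanh t * k t) t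
  deriv_pos : ∀ t, 0 < k t
  lt_one : ∀ t, h t < 1
  le_energy : ∀ t, 0 ≤ t → V (h t) ≤ k t ^ 2 / 2

namespace IsDoubleWell

variable {V : ℝ → ℝ} {N : ℕ} {h k : ℝ → ℝ} {s : ℝ}

/-- Every constant at least `1` is an equilibrium of the truncated equation, so by uniqueness the
shot would be that constant, contradicting `h 0 = 0`. -/
theorem not_one_le_of_isShot (hV : IsDoubleWell V) (H : IsShot N (clampedForce V) s h k)
    {t : ℝ} (hk : k t = 0) : ¬ 1 ≤ h t := by
  intro h1
  obtain ⟨L, hL⟩ := hV.exists_lipschitzWith_clampedForce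
  have := damped_unique (N := N) hL H.hasDerivAt H.hasDerivAt_deriv (h₂ := fun _ => h t)
    (k₂ := fun _ => 0) (t₀ := t) (fun u => hasDerivAt_const u _)
    (fun u => by simpa [hV.clampedForce_of_one_le h1] using hasDerivAt_const u (0 : ℝ)) rfl hk
  have h0 := congrFun this 0
  rw [H.init] at h0
  linarith

/-- This makes the two shooting sets disjoint. Above `1` the truncated potential vanishes and the
energy is nonnegative, so `h < 1` from `τ` on. An earlier excursion above `1` would have an interior
maximum, excluded by `not_one_le_of_isShot`. -/
theorem le_one_of_energy_neg (hV : IsDoubleWell V) (H : IsShot N (clampedForce V) s h k)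
    {τ : ℝ} (hτ : 0 ≤ τ) (he : k τ ^ 2 / 2 - clampedPotential V (h τ) < 0) {t : ℝ}
    (ht : 0 ≤ t) : h t ≤ 1 := by
  by_contra! h1
  have hlt : ∀ u, τ ≤ u → h u < 1 := fun u hu => by
    have := energy_antitoneOn H.hasDerivAt H.hasDerivAt_deriv hV.hasDerivAt_clampedPotential
      hτ (hτ.trans hu) hu
    by_contra! hu1
    have h0 := hV.clampedPotential_of_one_le_abs (hu1.trans (le_abs_self (h u)))
    have := sq_nonneg (k u)
    simp only at *
    linarith
  have htτ : t < τ := by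
    by_contra! h2
    linarith [hlt t h2]
  obtain ⟨m, hm, hmax⟩ := isCompact_Icc.exists_isMaxOn (s := Set.Icc 0 τ) ⟨t, ht, htτ.le⟩
    H.continuous.continuousOn
  have hm1 : 1 < h m := h1.trans_le (hmax (⟨ht, htτ.le⟩ : t ∈ Set.Icc 0 τ))
  have hm0 : m ≠ 0 := by rintro rfl; rw [H.init] at hm1; linarith
  have hmτ : m ≠ τ := by rintro rfl; linarith [hlt m le_rfl]
  have hloc : IsLocalMax h m := hmax.isLocalMax
    (Icc_mem_nhds (lt_of_le_of_ne hm.1 hm0.symm) (lt_of_le_of_ne hm.2 hmτ))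
  exact hV.not_one_le_of_isShot H (hloc.hasDerivAt_eq_zero (H.hasDerivAt m)) hm1.le

/-- On `[0, 1]`, `cosh^N k` starts at `s` and loses at most `cosh(1)^N M`, so this `s` keeps `k ≥
2`. -/
theorem one_lt_of_isShot {M : ℝ} (hM : ∀ t, |clampedForce V t| ≤ M)
    (hs : s = Real.cosh 1 ^ N * (M + 2)) (H : IsShot N (clampedForce V) s h k) : 1 < h 1 := by
  have hM0 : 0 ≤ M := (abs_nonneg _).trans (hM 0)
  have hp0 : ∀ t, 0 < Real.cosh t ^ N := fun t => pow_pos (Real.cosh_pos t) N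
  have hd : ∀ t, HasDerivAt (fun t => Real.cosh t ^ N * k t)
      (Real.cosh t ^ N * clampedForce V (h t)) t := fun t => by
    refine ((hasDerivAt_cosh_pow N t).mul (H.hasDerivAt_deriv t)).congr_deriv ?_
    ring
  have hpk : ∀ t ∈ Set.Icc (0 : ℝ) 1, 2 ≤ k t := by
    intro t ht
    have := (convex_Icc (0 : ℝ) 1).norm_image_sub_le_of_norm_hasDerivWithin_le
      (C := Real.cosh 1 ^ N * M) (fun u _ => (hd u).hasDerivWithinAt)
      (fun u hu => by
        rw [Real.norm_eq_abs, abs_mul, abs_of_pos (hp0 u)]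
        exact mul_le_mul (cosh_pow_le_of_mem ⟨by linarith [hu.1], hu.2⟩) (hM _) (abs_nonneg _)
          (hp0 1).le) (Set.left_mem_Icc.2 zero_le_one) ht
    simp only [Real.cosh_zero, one_pow, one_mul, H.init_deriv, sub_zero, Real.norm_eq_abs] at this
    rw [abs_of_nonneg ht.1] at this
    have h1 := (abs_le.1 this).1
    have h2 : Real.cosh 1 ^ N * M * t ≤ Real.cosh 1 ^ N * M :=
      mul_le_of_le_one_right (mul_nonneg (hp0 1).le hM0) ht.2
    have h3 : Real.cosh 1 ^ N * 2 ≤ Real.cosh t ^ N * k t := by rw [hs] at h1; linarith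
    have h4 : Real.cosh t ^ N ≤ Real.cosh 1 ^ N :=
      cosh_pow_le_of_mem ⟨by linarith [ht.1], ht.2⟩
    by_contra! h5
    nlinarith [hp0 t, hp0 1, mul_lt_mul_of_pos_left h5 (hp0 t)]
  have := (convex_Icc (0 : ℝ) 1).mul_sub_le_image_sub_of_le_deriv (f := h) (C := 2)
    H.continuous.continuousOn
    (fun t _ => (H.hasDerivAt t).differentiableAt.differentiableWithinAt)
    (fun t ht => by
      rw [(H.hasDerivAt t).deriv]; exact hpk t (interior_subset ht))
    0 (by norm_num) 1 (by norm_num) zero_le_one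
  rw [H.init] at this
  linarith

theorem exists_critical_isShot (hV : IsDoubleWell V) (N : ℕ) :
    ∃ s h k, 0 < s ∧ IsShot N (clampedForce V) s h k ∧ (∀ t, 0 < t → h t ≤ 1) ∧
      ∀ t, 0 < t → clampedPotential V (h t) ≤ k t ^ 2 / 2 := by
  obtain ⟨L, hL⟩ := hV.exists_lipschitzWith_clampedForce
  obtain ⟨M, hM'⟩ := hV.exists_abs_deriv_le
  have hM : ∀ t, |clampedForce V t| ≤ M := fun t => hM' _ (clamp_mem_Icc t)
  have hM0 : 0 ≤ M := (abs_nonneg _).trans (hM 0)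
  choose h k H using exists_isShot N hL hM
  have hcG : Continuous (clampedPotential V) :=
    continuous_iff_continuousAt.2 fun t => (hV.hasDerivAt_clampedPotential t).continuousAt
  set hi : Set ℝ := ⋃ t ∈ Set.Ioi (0 : ℝ), {s | 1 < h s t} with hover
  set lo : Set ℝ := ⋃ t ∈ Set.Ioi (0 : ℝ),
    {s | k s t ^ 2 / 2 - clampedPotential V (h s t) < 0} with hunder
  have hoo : IsOpen hi := isOpen_biUnion fun t ht =>
    isOpen_lt continuous_const (continuous_shots hL H (le_of_lt ht)).1
  have huo : IsOpen lo := isOpen_biUnion fun t ht => by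
    obtain ⟨c1, c2⟩ := continuous_shots hL H (le_of_lt ht)
    exact isOpen_lt (by fun_prop) continuous_const
  -- At zero slope the energy starts at `-V 0 < 0`; it is read at time `1` because `lo` only uses
  -- positive times.
  have h0u : (0 : ℝ) ∈ lo := by
    refine Set.mem_biUnion (Set.mem_Ioi.2 one_pos) ?_
    have := energy_antitoneOn (H 0).hasDerivAt (H 0).hasDerivAt_deriv
      hV.hasDerivAt_clampedPotential (Set.self_mem_Ici) (Set.mem_Ici.2 zero_le_one) zero_le_one
    simp only [(H 0).init, (H 0).init_deriv] at this
    rw [hV.clampedPotential_of_mem (t := 0) (by norm_num)] at this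
    have hp := hV.pos_of_abs_lt (t := 0) (by norm_num)
    simp only [Set.mem_ofPred_eq]
    linarith
  have hso : Real.cosh 1 ^ N * (M + 2) ∈ hi :=
    Set.mem_biUnion (Set.mem_Ioi.2 one_pos) (one_lt_of_isShot hM rfl (H _))
  have hdisj : ∀ s, s ∈ hi → s ∉ lo := by
    intro s ho hu
    simp only [hover, hunder, Set.mem_iUnion, Set.mem_Ioi, Set.mem_ofPred_eq] at ho hu
    obtain ⟨t, ht, h1⟩ := ho
    obtain ⟨τ, hτ, he⟩ := hu
    exact absurd (hV.le_one_of_energy_neg (H s) hτ.le he ht.le) (not_le.2 h1)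
  obtain ⟨s, hs0, hs⟩ : ∃ s, 0 ≤ s ∧ s ∉ hi ∪ lo := by
    by_contra! hcon
    have := isPreconnected_Ici (a := (0 : ℝ)) hi lo hoo huo hcon
      ⟨_, mul_nonneg (pow_pos (Real.cosh_pos 1) N).le (by linarith), hso⟩ ⟨0, Set.self_mem_Ici, h0u⟩
    obtain ⟨s, -, ho, hu⟩ := this
    exact hdisj s ho hu
  simp only [hover, hunder, Set.mem_union, Set.mem_iUnion, Set.mem_Ioi, Set.mem_ofPred_eq,
    not_or, not_exists, not_lt] at hs
  have hs0' : s ≠ 0 := by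
    rintro rfl
    simp only [hunder, Set.mem_iUnion, Set.mem_Ioi, Set.mem_ofPred_eq] at h0u
    obtain ⟨t, ht, h1⟩ := h0u
    linarith [hs.2 t ht]
  exact ⟨s, h s, k s, lt_of_le_of_ne hs0 hs0'.symm, H s, hs.1,
    fun t ht => by linarith [hs.2 t ht]⟩

theorem exists_isKink (hV : IsDoubleWell V) (N : ℕ) : ∃ h k, IsKink N V h k := by
  obtain ⟨s, h, k, hs, H, hle, he⟩ := hV.exists_critical_isShot N
  obtain ⟨L, hL⟩ := hV.exists_lipschitzWith_clampedForce
  have hodd := H.odd hL hV.clampedForce_neg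
  have heven := H.deriv_even hodd
  have hlt : ∀ t, 0 ≤ t → h t < 1 := by
    intro t ht
    rcases ht.eq_or_lt with rfl | ht
    · rw [H.init]; exact one_pos
    refine lt_of_le_of_ne (hle t ht) fun h1 => ?_
    have hloc : IsLocalMax h t := by
      filter_upwards [Ioi_mem_nhds ht] with u hu
      rw [h1]; exact hle u hu
    exact hV.not_one_le_of_isShot H (hloc.hasDerivAt_eq_zero (H.hasDerivAt t)) h1.ge
  have hkpos : ∀ t, 0 ≤ t → 0 < k t := by
    intro t ht
    by_contra! hkt
    -- At the first zero `m` of `k`, `h` has only increased, so `0 ≤ h m < 1` and the energy there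
    -- is `-V (h m) < 0`, which is excluded.
    obtain ⟨m, hm, hleast⟩ := (isCompact_Icc.inter_right
      (isClosed_le H.continuous_deriv continuous_const)).exists_isLeast
      (⟨t, ⟨ht, le_rfl⟩, hkt⟩ : (Set.Icc 0 t ∩ {u | k u ≤ 0}).Nonempty)
    have hbefore : ∀ u, 0 ≤ u → u < m → 0 < k u := fun u hu hum => by
      by_contra! hc
      exact absurd (hleast ⟨⟨hu, hum.le.trans hm.1.2⟩, hc⟩) (not_le.2 hum)
    obtain ⟨z, hz, hkz⟩ := intermediate_value_Icc' hm.1.1 H.continuous_deriv.continuousOn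
      (⟨hm.2, by rw [H.init_deriv]; exact hs.le⟩ : (0 : ℝ) ∈ Set.Icc (k m) (k 0))
    have hzm : z = m := by
      by_contra hne
      linarith [hbefore z hz.1 (lt_of_le_of_ne hz.2 hne)]
    subst hzm
    have hz0 : 0 < z := lt_of_le_of_ne hz.1 (by rintro rfl; linarith [H.init_deriv])
    have hmono : MonotoneOn h (Set.Icc 0 z) := monotoneOn_of_deriv_nonneg (convex_Icc 0 z)
      H.continuous.continuousOn
      (fun u _ => (H.hasDerivAt u).differentiableAt.differentiableWithinAt) fun u hu => by
        rw [interior_Icc] at hu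
        rw [(H.hasDerivAt u).deriv]
        exact (hbefore u hu.1.le hu.2).le
    have hz1 := hmono (Set.left_mem_Icc.2 hz.1) (Set.right_mem_Icc.2 hz.1) hz.1
    rw [H.init] at hz1
    have h1 := hlt z hz.1
    have h2 := he z hz0
    rw [hkz, hV.clampedPotential_of_mem ⟨by linarith, h1.le⟩] at h2
    have := hV.pos_of_abs_lt (t := h z) (abs_lt.2 ⟨by linarith, h1⟩)
    norm_num at h2
    linarith
  have hkpos' : ∀ t, 0 < k t := fun t => by
    rcases le_total 0 t with ht | ht
    · exact hkpos t ht
    · rw [← heven]; exact hkpos _ (by linarith)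
  have hmono : StrictMono h := strictMono_of_deriv_pos fun t => by
    rw [(H.hasDerivAt t).deriv]; exact hkpos' t
  have hlt' : ∀ t, h t < 1 := fun t => by
    rcases le_total 0 t with ht | ht
    · exact hlt t ht
    · have := hmono.monotone ht
      rw [H.init] at this; linarith
  have hmem : ∀ t, h t ∈ Set.Icc (-1 : ℝ) 1 := fun t => by
    have := hlt' (-t)
    rw [hodd t] at this
    exact ⟨by linarith, (hlt' t).le⟩
  refine ⟨h, k, hodd, H.hasDerivAt, fun t => ?_, hkpos', hlt', fun t ht => ?_⟩
  · rw [← clampedForce_of_mem (hmem t)]; exact H.hasDerivAt_deriv t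
  · rw [← hV.clampedPotential_of_mem (hmem t)]
    rcases ht.eq_or_lt with rfl | ht
    -- The critical shot controls positive times only; time `0` follows by continuity.
    · refine le_of_tendsto_of_tendsto (b := 𝓝[>] (0 : ℝ))
        (((hV.hasDerivAt_clampedPotential _).continuousAt.comp
          H.continuous.continuousAt).mono_left nhdsWithin_le_nhds)
        (((H.continuous_deriv.pow 2).div_const 2).continuousAt.mono_left nhdsWithin_le_nhds) ?_
      filter_upwards [self_mem_nhdsWithin] with t ht using he t ht
    · exact he t ht

end IsDoubleWell

/-! ### Pointwise estimates on kinks. -/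

theorem tanh_monotone : Monotone Real.tanh := fun a b hab => by
  rw [Real.tanh_eq_sinh_div_cosh, Real.tanh_eq_sinh_div_cosh,
    div_le_div_iff₀ (Real.cosh_pos a) (Real.cosh_pos b)]
  have := Real.sinh_nonneg_iff.2 (sub_nonneg.2 hab)
  rw [Real.sinh_sub] at this
  linarith

theorem continuous_tanh : Continuous Real.tanh := by
  have : Real.tanh = fun t => Real.sinh t / Real.cosh t := funext Real.tanh_eq_sinh_div_cosh
  rw [this]
  exact Real.continuous_sinh.div Real.continuous_cosh fun t => (Real.cosh_pos t).ne'

namespace IsKink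

variable {N : ℕ} {V h k : ℝ → ℝ}

theorem apply_zero (H : IsKink N V h k) : h 0 = 0 := H.odd.map_zero

theorem continuous (H : IsKink N V h k) : Continuous h :=
  continuous_iff_continuousAt.2 fun t => (H.hasDerivAt t).continuousAt

theorem continuous_deriv (H : IsKink N V h k) : Continuous k :=
  continuous_iff_continuousAt.2 fun t => (H.hasDerivAt_deriv t).continuousAt

theorem differentiable (H : IsKink N V h k) : Differentiable ℝ h := fun t =>
  (H.hasDerivAt t).differentiableAt

theorem deriv_eq (H : IsKink N V h k) : deriv h = k := funext fun t => (H.hasDerivAt t).deriv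

theorem strictMono (H : IsKink N V h k) : StrictMono h :=
  strictMono_of_deriv_pos fun t => by rw [H.deriv_eq]; exact H.deriv_pos t

theorem nonneg (H : IsKink N V h k) {t : ℝ} (ht : 0 ≤ t) : 0 ≤ h t :=
  H.apply_zero ▸ H.strictMono.monotone ht

theorem neg_one_lt (H : IsKink N V h k) (t : ℝ) : -1 < h t := by
  have := H.lt_one (-t)
  rw [H.odd t] at this
  linarith

theorem deriv_even (H : IsKink N V h k) (t : ℝ) : k (-t) = k t := by
  have h1 := ((H.hasDerivAt (-t)).comp t (hasDerivAt_neg t)).neg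
  have h2 : (-(h ∘ Neg.neg)) = h := by
    funext u; simp [H.odd u]
  rw [h2] at h1
  simpa using h1.unique (H.hasDerivAt t)

/-- If `h τ ≤ c`, then `V (h t) ≥ V c` on `[0, τ]`, so `k ≥ √(2 V c)` there, and integrating gives
`h τ > 1`. -/
theorem lt_of_one_lt_mul (H : IsKink N V h k) (hV : IsDoubleWell V) {c τ : ℝ} (hc0 : 0 ≤ c)
    (hc1 : c ≤ 1) (hτ : 0 ≤ τ) (hcτ : 1 < √(2 * V c) * τ) : c < h τ := by
  by_contra! hle
  have := (convex_Icc (0 : ℝ) τ).mul_sub_le_image_sub_of_le_deriv (f := h) (C := √(2 * V c))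
    H.continuous.continuousOn H.differentiable.differentiableOn
    (fun t ht => by
      have ht' := interior_subset ht
      rw [H.deriv_eq]
      have h1 : h t ≤ c := (H.strictMono.monotone ht'.2).trans hle
      have h0 := H.nonneg ht'.1
      have h2 := hV.strictAntiOn.antitoneOn ⟨h0, h1.trans hc1⟩ ⟨hc0, hc1⟩ h1
      have h3 := H.le_energy t ht'.1
      exact Real.sqrt_le_iff.2 ⟨(H.deriv_pos t).le, by linarith⟩)
    0 (Set.left_mem_Icc.2 hτ) τ (Set.right_mem_Icc.2 hτ) hτ
  rw [H.apply_zero] at this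
  linarith [H.lt_one τ]

theorem tendsto_atTop (H : IsKink N V h k) (hV : IsDoubleWell V) :
    Tendsto h atTop (𝓝 1) := by
  refine tendsto_order.2 ⟨fun a ha => ?_, fun a ha =>
    Eventually.of_forall fun t => (H.lt_one t).trans ha⟩
  set c := max 0 a
  have hc1 : c < 1 := max_lt one_pos ha
  have hc0 : 0 ≤ c := le_max_left _ _
  have hb : 0 < √(2 * V c) := Real.sqrt_pos.2 (by
    have := hV.pos_of_abs_lt (t := c) (by rwa [abs_of_nonneg hc0])
    positivity)
  filter_upwards [eventually_gt_atTop (1 / √(2 * V c)), eventually_ge_atTop 0] with t ht ht0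
  refine (le_max_right 0 a).trans_lt (H.lt_of_one_lt_mul hV hc0 hc1.le ht0 ?_)
  rwa [div_lt_iff₀' hb] at ht

theorem tendsto_atBot (H : IsKink N V h k) (hV : IsDoubleWell V) :
    Tendsto h atBot (𝓝 (-1)) := by
  have := ((H.tendsto_atTop hV).comp tendsto_neg_atBot_atTop).neg
  refine this.congr fun t => ?_
  simp [H.odd t]

theorem deriv_antitoneOn (H : IsKink N V h k) (hV : IsDoubleWell V) :
    AntitoneOn k (Set.Ici 0) := by
  refine antitoneOn_of_deriv_nonpos (convex_Ici 0) H.continuous_deriv.continuousOn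
    (fun t _ => (H.hasDerivAt_deriv t).differentiableAt.differentiableWithinAt) fun t ht => ?_
  have ht0 : 0 ≤ t := interior_subset ht
  rw [(H.hasDerivAt_deriv t).deriv]
  have h1 := hV.deriv_nonpos ⟨H.nonneg ht0, (H.lt_one t).le⟩
  have h2 : 0 ≤ N * Real.tanh t * k t :=
    mul_nonneg (mul_nonneg (by positivity) (tanh_nonneg ht0)) (H.deriv_pos t).le
  linarith

theorem deriv_mul_le_one (H : IsKink N V h k) (hV : IsDoubleWell V) {τ : ℝ} (hτ : 0 ≤ τ) :
    k τ * τ ≤ 1 := by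
  have := (convex_Icc (0 : ℝ) τ).mul_sub_le_image_sub_of_le_deriv (f := h) (C := k τ)
    H.continuous.continuousOn H.differentiable.differentiableOn
    (fun t ht => by
      have ht' := interior_subset ht
      rw [H.deriv_eq]
      exact H.deriv_antitoneOn hV ht'.1 hτ ht'.2)
    0 (Set.left_mem_Icc.2 hτ) τ (Set.right_mem_Icc.2 hτ) hτ
  rw [H.apply_zero] at this
  linarith [H.lt_one τ]

/-- The function `k + M t + N h` is nondecreasing, because `tanh ≤ 1` and `V' ≥ -M`. Comparing `0`
with `δ` and using `k δ ≤ 1/δ` gives the bound; `δ` is left free to be matched to `ε`. -/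
theorem deriv_zero_le (H : IsKink N V h k) (hV : IsDoubleWell V) {M δ : ℝ} (hδ : 0 < δ)
    (hM : ∀ t ∈ Set.Icc (-1 : ℝ) 1, |deriv V t| ≤ M) : k 0 ≤ 1 / δ + M * δ + N := by
  have hd : ∀ t, HasDerivAt (fun t => k t + M * t + N * h t)
      (deriv V (h t) - N * Real.tanh t * k t + M + N * k t) t := fun t =>
    (((H.hasDerivAt_deriv t).add ((hasDerivAt_id t).const_mul M)).add
      ((H.hasDerivAt t).const_mul (N : ℝ))).congr_deriv (by ring)
  have hmono : Monotone (fun t => k t + M * t + N * h t) :=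
    monotone_of_deriv_nonneg (fun t => (hd t).differentiableAt) fun t => by
      rw [(hd t).deriv]
      have h1 := (abs_le.1 (hM (h t) ⟨(H.neg_one_lt t).le, (H.lt_one t).le⟩)).1
      have h2 : 0 ≤ N * ((1 - Real.tanh t) * k t) :=
        mul_nonneg (by positivity) (mul_nonneg (by linarith [Real.tanh_lt_one t])
          (H.deriv_pos t).le)
      linarith
  have h1 := hmono hδ.le
  simp only [H.apply_zero, mul_zero, add_zero] at h1
  have h2 : k δ ≤ 1 / δ := by
    rw [le_div_iff₀ hδ]; exact H.deriv_mul_le_one hV hδ.le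
  have h3 : N * h δ ≤ N := mul_le_of_le_one_right (by positivity) (H.lt_one δ).le
  linarith

end IsKink

/-! ### The weighted energy of a kink. -/

theorem setLIntegral_Ioc_le_sub {f F F' : ℝ → ℝ} {a b : ℝ} (hab : a ≤ b)
    (hF : ∀ t ∈ Set.Icc a b, HasDerivAt F (F' t) t) (hF' : ContinuousOn F' (Set.Icc a b))
    (hF0 : ∀ t ∈ Set.Icc a b, 0 ≤ F' t) (hf : ∀ t ∈ Set.Icc a b, f t ≤ F' t) :
    ∫⁻ t in Set.Ioc a b, ENNReal.ofReal (f t) ≤ ENNReal.ofReal (F b - F a) := by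
  have hint : IntervalIntegrable F' volume a b :=
    ContinuousOn.intervalIntegrable (by rwa [Set.uIcc_of_le hab])
  have hI := intervalIntegral.integral_eq_sub_of_hasDerivAt (f := F) (f' := F') (a := a) (b := b)
    (by rwa [Set.uIcc_of_le hab]) hint
  rw [← hI, intervalIntegral.integral_of_le hab, ofReal_integral_eq_lintegral_ofReal hint.1]
  · exact setLIntegral_mono' measurableSet_Ioc fun t ht =>
      ENNReal.ofReal_le_ofReal (hf t (Set.Ioc_subset_Icc_self ht))
  · exact (ae_restrict_iff' measurableSet_Ioc).2
      (Eventually.of_forall fun t ht => hF0 t (Set.Ioc_subset_Icc_self ht))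

/-- Exhausting by bounded intervals needs only an upper bound on the primitive, so finiteness of the
energy is a conclusion. -/
theorem setLIntegral_Ioi_le_sub {f F F' : ℝ → ℝ} {a B : ℝ}
    (hF : ∀ t, a ≤ t → HasDerivAt F (F' t) t) (hF' : ContinuousOn F' (Set.Ici a))
    (hF0 : ∀ t, a ≤ t → 0 ≤ F' t) (hf : ∀ t, a ≤ t → f t ≤ F' t) (hB : ∀ t, a ≤ t → F t ≤ B) :
    ∫⁻ t in Set.Ioi a, ENNReal.ofReal (f t) ≤ ENNReal.ofReal (B - F a) := by
  have hU : Set.Ioi a = ⋃ n : ℕ, Set.Ioc a (a + n) := by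
    ext t
    simp only [Set.mem_Ioi, Set.mem_iUnion, Set.mem_Ioc]
    refine ⟨fun h => ?_, fun ⟨_, h, _⟩ => h⟩
    obtain ⟨n, hn⟩ := exists_nat_ge (t - a)
    exact ⟨n, h, by linarith⟩
  have hmono : Monotone fun n : ℕ => Set.Ioc a (a + n) := fun m n hmn =>
    Set.Ioc_subset_Ioc_right (by gcongr)
  rw [hU, setLIntegral_iUnion_of_directed _ hmono.directed_le]
  refine iSup_le fun n => ?_
  have hn : a ≤ a + n := by simp
  refine (setLIntegral_Ioc_le_sub hn (fun t ht => hF t ht.1) (hF'.mono Set.Icc_subset_Ici_self)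
    (fun t ht => hF0 t ht.1) fun t ht => hf t ht.1).trans (ENNReal.ofReal_le_ofReal ?_)
  linarith [hB _ hn]

theorem lintegral_eq_two_mul_of_even {f : ℝ → ℝ≥0∞} (hf : ∀ t, f (-t) = f t) :
    ∫⁻ t, f t = 2 * ∫⁻ t in Set.Ioi 0, f t := by
  have h1 : ∫⁻ t in Set.Iio (0 : ℝ), f t = ∫⁻ t in Set.Ioi 0, f t := by
    have := (Measure.measurePreserving_neg (volume : Measure ℝ)).setLIntegral_comp_preimage_emb
      (MeasurableEquiv.neg ℝ).measurableEmbedding f (Set.Ioi 0)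
    simpa [hf] using this
  rw [← lintegral_add_compl f (measurableSet_Ioi (a := (0 : ℝ))), Set.compl_Ioi,
    ← setLIntegral_congr Iio_ae_eq_Iic, h1, two_mul]

namespace IsKink

variable {N : ℕ} {V h k : ℝ → ℝ}

/-- A Pohozaev-type identity: differentiating the weight turns the difference of kinetic and
potential terms into minus their sum, the energy density itself. -/
theorem hasDerivAt_weighted_energy (H : IsKink N V h k) (hV : IsDoubleWell V) (t : ℝ) :
    HasDerivAt (fun t => Real.cosh t ^ N * (k t ^ 2 / 2 - V (h t)))
      (-(N * Real.tanh t * ((1 / 2 * k t ^ 2 + V (h t)) * Real.cosh t ^ N))) t := by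
  refine ((hasDerivAt_cosh_pow N t).mul ((((H.hasDerivAt_deriv t).pow 2).div_const 2).sub
    ((hV.differentiable (h t)).hasDerivAt.comp t (H.hasDerivAt t)))).congr_deriv ?_
  simp only [Pi.sub_apply, Pi.pow_apply, Function.comp_apply]
  push_cast; ring

theorem density_le (H : IsKink N V h k) (hV : IsDoubleWell V) {a t : ℝ} (ha : 0 ≤ a)
    (hat : a ≤ t) : 1 / 2 * k t ^ 2 + V (h t) ≤ k a * k t := by
  have h1 := H.le_energy t (ha.trans hat)
  have h2 := mul_le_mul_of_nonneg_right (H.deriv_antitoneOn hV ha (ha.trans hat) hat)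
    (H.deriv_pos t).le
  linarith

/-- For `N ≥ 1` the density is at most the derivative of minus the weighted energy over `tanh 1`, a
primitive bounded above by `0`; `k 1 ≤ 1` controls its value at `1`. For `N = 0` that identity is
void, but the density is at most `k`, with primitive `h`. -/
theorem setLIntegral_tail_le (H : IsKink N V h k) (hV : IsDoubleWell V) :
    ∫⁻ t in Set.Ioi (1 : ℝ), ENNReal.ofReal ((1 / 2 * k t ^ 2 + V (h t)) * Real.cosh t ^ N) ≤
      ENNReal.ofReal (Real.cosh 1 ^ N / Real.tanh 1) := by
  have ht1 : 0 < Real.tanh 1 := by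
    rw [Real.tanh_eq_sinh_div_cosh]
    exact div_pos (Real.sinh_pos_iff.2 one_pos) (Real.cosh_pos 1)
  have hk1 : k 1 ≤ 1 := by simpa using H.deriv_mul_le_one hV zero_le_one
  rcases Nat.eq_zero_or_pos N with rfl | hN
  · refine (setLIntegral_Ioi_le_sub (F := h) (F' := k) (B := 1) (fun t _ => H.hasDerivAt t)
      H.continuous_deriv.continuousOn (fun t _ => (H.deriv_pos t).le) (fun t ht => ?_)
      fun t _ => (H.lt_one t).le).trans (ENNReal.ofReal_le_ofReal ?_)
    · have := H.density_le hV zero_le_one ht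
      have := mul_le_of_le_one_left (H.deriv_pos t).le hk1
      rw [pow_zero, mul_one]
      linarith
    · rw [pow_zero]
      have := (one_le_div ht1).2 (Real.tanh_lt_one 1).le
      linarith [H.nonneg zero_le_one]
  · have hN' : (1 : ℝ) ≤ N := by exact_mod_cast hN
    have hc : Continuous fun t : ℝ => (1 / 2 * k t ^ 2 + V (h t)) * Real.cosh t ^ N := by
      have := H.continuous
      have := H.continuous_deriv
      have := hV.contDiff.continuous
      have := Real.continuous_cosh
      fun_prop
    have hct := continuous_tanh
    have hD0 : ∀ t, 0 ≤ (1 / 2 * k t ^ 2 + V (h t)) * Real.cosh t ^ N := fun t =>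
      mul_nonneg (add_nonneg (by positivity) (hV.nonneg _)) (pow_pos (Real.cosh_pos t) N).le
    have htm : ∀ t, 1 ≤ t → Real.tanh 1 ≤ N * Real.tanh t := fun t ht => by
      have h1 : Real.tanh 1 ≤ Real.tanh t := tanh_monotone ht
      nlinarith
    refine (setLIntegral_Ioi_le_sub
      (F := fun t => -(Real.cosh t ^ N * (k t ^ 2 / 2 - V (h t))) / Real.tanh 1)
      (F' := fun t => -(-(N * Real.tanh t * ((1 / 2 * k t ^ 2 + V (h t)) * Real.cosh t ^ N)))
        / Real.tanh 1)
      (B := 0) (fun t _ => ((H.hasDerivAt_weighted_energy hV t).neg.div_const _))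
      (Continuous.continuousOn (by fun_prop)) (fun t ht => ?_) (fun t ht => ?_)
      fun t ht => ?_).trans (ENNReal.ofReal_le_ofReal ?_)
    · rw [neg_neg]
      exact div_nonneg (mul_nonneg (ht1.le.trans (htm t ht)) (hD0 t)) ht1.le
    · rw [neg_neg, le_div_iff₀ ht1, mul_comm]
      exact mul_le_mul_of_nonneg_right (htm t ht) (hD0 t)
    · refine div_nonpos_of_nonpos_of_nonneg (neg_nonpos.2 ?_) ht1.le
      exact mul_nonneg (pow_pos (Real.cosh_pos t) N).le
        (sub_nonneg.2 (H.le_energy t (zero_le_one.trans ht)))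
    · rw [neg_div, zero_sub, neg_neg]
      refine div_le_div_of_nonneg_right ?_ ht1.le
      refine mul_le_of_le_one_right (pow_pos (Real.cosh_pos 1) N).le ?_
      have := hV.nonneg (h 1)
      have := H.deriv_pos 1
      nlinarith

theorem lintegral_energy_le (H : IsKink N V h k) (hV : IsDoubleWell V) :
    ∫⁻ t, ENNReal.ofReal ((1 / 2 * k t ^ 2 + V (h t)) * Real.cosh t ^ N) ≤
      ENNReal.ofReal (2 * (Real.cosh 1 ^ N * k 0 + Real.cosh 1 ^ N / Real.tanh 1)) := by
  have hp0 : ∀ t, 0 < Real.cosh t ^ N := fun t => pow_pos (Real.cosh_pos t) N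
  have hcore : ∫⁻ t in Set.Ioc (0 : ℝ) 1,
      ENNReal.ofReal ((1 / 2 * k t ^ 2 + V (h t)) * Real.cosh t ^ N) ≤
      ENNReal.ofReal (Real.cosh 1 ^ N * k 0) := by
    have hA : 0 ≤ Real.cosh 1 ^ N * k 0 := mul_nonneg (hp0 1).le (H.deriv_pos 0).le
    refine (setLIntegral_Ioc_le_sub (F := fun t => Real.cosh 1 ^ N * k 0 * h t)
      (F' := fun t => Real.cosh 1 ^ N * k 0 * k t) zero_le_one
      (fun t _ => (H.hasDerivAt t).const_mul _)
      (H.continuous_deriv.const_mul _).continuousOn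
      (fun t _ => mul_nonneg hA (H.deriv_pos t).le) fun t ht => ?_).trans
      (ENNReal.ofReal_le_ofReal ?_)
    · have h1 := mul_le_mul (H.density_le hV le_rfl ht.1)
        (cosh_pow_le_of_mem (N := N) (t := t) (T := 1) ⟨by linarith [ht.1], ht.2⟩) (hp0 t).le
        (mul_nonneg (H.deriv_pos 0).le (H.deriv_pos t).le)
      linarith
    · rw [H.apply_zero, mul_zero, sub_zero]
      exact mul_le_of_le_one_right hA (H.lt_one 1).le
  rw [lintegral_eq_two_mul_of_even, ← Set.Ioc_union_Ioi_eq_Ioi (zero_le_one (α := ℝ)),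
    ENNReal.ofReal_mul zero_le_two, ENNReal.ofReal_ofNat,
    ENNReal.ofReal_add (mul_nonneg (hp0 1).le (H.deriv_pos 0).le)
      (div_nonneg (hp0 1).le (tanh_nonneg zero_le_one))]
  · gcongr
    exact (lintegral_union_le _ _ _).trans (add_le_add hcore (H.setLIntegral_tail_le hV))
  · intro t
    rw [H.deriv_even, H.odd, ← hV.even, Real.cosh_neg]

end IsKink

/-! ### Rescaling, uniform bounds and the limit `ε → 0`. -/

theorem deriv_scaledPotential (W : ℝ → ℝ) (ε : ℝ) :
    deriv (scaledPotential W ε) = fun t => 1 / ε ^ 2 * deriv W t := by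
  funext t
  exact deriv_const_mul_field _

theorem IsDoubleWell.scaledPotential {W : ℝ → ℝ} (hW : IsDoubleWell W) {ε : ℝ} (hε : 0 < ε) :
    IsDoubleWell (scaledPotential W ε) := by
  have hc : 0 < 1 / ε ^ 2 := by positivity
  refine ⟨contDiff_const.mul hW.contDiff, fun t => mul_nonneg hc.le (hW.nonneg t), fun t => ?_,
    fun t => ?_, ?_, fun a ha b hb hab => ?_, fun a ha b hb hab => ?_⟩
  · simp only [_root_.scaledPotential]; rw [← hW.even]
  · rw [← hW.zero_iff]
    simp [_root_.scaledPotential, hε.ne']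
  · rw [deriv_scaledPotential, deriv_const_mul_field]
    exact mul_pos hc hW.second_deriv_pos
  · exact mul_lt_mul_of_pos_left (hW.strictAntiOn ha hb hab) hc
  · exact mul_lt_mul_of_pos_left (hW.strictMonoOn ha hb hab) hc

theorem IsKink.isProfile {n : ℕ} (hn : 1 ≤ n) {W h k : ℝ → ℝ} {ε : ℝ}
    (hV : IsDoubleWell (scaledPotential W ε)) (H : IsKink (n - 1) (scaledPotential W ε) h k) :
    IsProfile n W ε h := by
  have hk' : deriv k = fun t => deriv (scaledPotential W ε) (h t) -
      ((n - 1 : ℕ) : ℝ) * Real.tanh t * k t := funext fun t => (H.hasDerivAt_deriv t).deriv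
  have hkc : ContDiff ℝ 1 k := by
    refine contDiff_one_iff_deriv.2 ⟨fun t => (H.hasDerivAt_deriv t).differentiableAt, ?_⟩
    rw [hk']
    have hct := continuous_tanh
    exact (hV.continuous_deriv.comp H.continuous).sub
      ((continuous_const.mul hct).mul H.continuous_deriv)
  refine ⟨?_, fun τ => ?_, H.tendsto_atTop hV, H.tendsto_atBot hV⟩
  · refine (contDiff_succ_iff_deriv (n := 1) (f := h)).2 ⟨H.differentiable, by simp, ?_⟩
    rwa [H.deriv_eq]
  · rw [H.deriv_eq, hk', nonlinearity, neg_neg, Nat.cast_sub hn, Nat.cast_one]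
    ring

theorem IsKink.exists_profileEnergy_le {n : ℕ} {W : ℝ → ℝ} (hW : IsDoubleWell W) (ε₀ : ℝ)
    (hε₀ : 0 < ε₀) : ∃ C : ℝ, 0 < C ∧ ∀ ε : ℝ, 0 < ε → ε ≤ ε₀ → ∀ h k : ℝ → ℝ,
      IsKink (n - 1) (scaledPotential W ε) h k →
      profileEnergy n W ε h ≤ ENNReal.ofReal (C / ε) := by
  obtain ⟨M, hM⟩ := hW.exists_abs_deriv_le
  have hM0 : 0 ≤ M := (abs_nonneg _).trans (hM 0 (by norm_num))
  set P := Real.cosh 1 ^ (n - 1)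
  have hP : 0 < P := pow_pos (Real.cosh_pos 1) _
  have ht := tanh_nonneg zero_le_one
  refine ⟨2 * (P * (1 + M + (n - 1 : ℕ) * ε₀) + P / Real.tanh 1 * ε₀), by positivity,
    fun ε hε hεε₀ h k H => ?_⟩
  have hV := hW.scaledPotential hε
  rw [profileEnergy, H.deriv_eq]
  refine (H.lintegral_energy_le hV).trans (ENNReal.ofReal_le_ofReal ?_)
  -- With `δ = ε` and force bound `M / ε²`, both `1/δ` and `(M / ε²) δ` are of order `1/ε`.
  have hk := H.deriv_zero_le hV (M := M / ε ^ 2) hε fun t ht => by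
    rw [deriv_scaledPotential, abs_mul, abs_of_pos (by positivity), one_div_mul_eq_div]
    exact div_le_div_of_nonneg_right (hM t ht) (by positivity)
  have hkε : k 0 * ε ≤ 1 + M + (n - 1 : ℕ) * ε₀ := by
    have h1 := mul_le_mul_of_nonneg_right hk hε.le
    have h2 : (1 / ε + M / ε ^ 2 * ε + (n - 1 : ℕ)) * ε = 1 + M + (n - 1 : ℕ) * ε := by
      field_simp
    have h3 : ((n - 1 : ℕ) : ℝ) * ε ≤ (n - 1 : ℕ) * ε₀ := by gcongr
    linarith
  rw [le_div_iff₀ hε]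
  have h1 := mul_le_mul_of_nonneg_left hkε hP.le
  have h2 : P / Real.tanh 1 * ε ≤ P / Real.tanh 1 * ε₀ := by gcongr
  linarith

theorem tendstoLocallyUniformlyOn_sign_of_isKink {N : ℕ} {W : ℝ → ℝ} (hW : IsDoubleWell W)
    {h k : ℝ → ℝ → ℝ} (H : ∀ ε, 0 < ε → IsKink N (scaledPotential W ε) (h ε) (k ε)) :
    TendstoLocallyUniformlyOn h Real.sign (𝓝[>] 0) ({0}ᶜ : Set ℝ) := by
  refine Metric.tendstoLocallyUniformlyOn_iff.2 fun η hη x hx => ?_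
  have hx0 : 0 < |x| := abs_pos.2 hx
  refine ⟨{y | |x| / 2 < |y|}, mem_nhdsWithin_of_mem_nhds
    ((isOpen_lt continuous_const continuous_abs).mem_nhds (by
      simp only [Set.mem_ofPred_eq]; linarith)), ?_⟩
  set c := max 0 (1 - η)
  have hc0 : 0 ≤ c := le_max_left _ _
  have hc1 : c < 1 := max_lt one_pos (by linarith)
  have hb : 0 < √(2 * W c) := Real.sqrt_pos.2 (by
    have := hW.pos_of_abs_lt (t := c) (by rwa [abs_of_nonneg hc0])
    positivity)
  -- Below this threshold, `√(2 W c) / ε` times any `z > |x|/2` exceeds `1`, so `h ε z > c ≥ 1 - η`,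
  -- uniformly in `z`.
  filter_upwards [Ioo_mem_nhdsGT (show 0 < √(2 * W c) * (|x| / 2) by positivity)]
    with ε hε y hy
  have hε0 := hε.1
  have hV := hW.scaledPotential hε0
  have hpos : ∀ z, |x| / 2 < z → |1 - h ε z| < η := fun z hz => by
    have hz0 : 0 < z := by linarith
    have h1 : 1 < √(2 * scaledPotential W ε c) * z := by
      have : 2 * scaledPotential W ε c = 2 * W c / ε ^ 2 := by
        rw [scaledPotential]; ring
      rw [this, Real.sqrt_div' _ (by positivity), Real.sqrt_sq hε0.le, div_mul_eq_mul_div,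
        one_lt_div hε0]
      exact hε.2.trans (mul_lt_mul_of_pos_left hz hb)
    have h2 := (H ε hε0).lt_of_one_lt_mul hV hc0 hc1.le hz0.le h1
    have h3 := (H ε hε0).lt_one z
    rw [abs_of_pos (by linarith)]
    linarith [le_max_right 0 (1 - η)]
  have hy' : |x| / 2 < |y| := hy
  rw [Real.dist_eq]
  rcases lt_or_ge y 0 with h0 | h0
  · rw [abs_of_neg h0] at hy'
    have := hpos _ hy'
    rw [(H ε hε0).odd] at this
    rw [Real.sign_of_neg h0, ← abs_neg]
    convert this using 2
    ring
  · rw [abs_of_nonneg h0] at hy'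
    rw [Real.sign_of_pos (by linarith)]
    exact hpos _ hy'

theorem proposition3p1 (n : ℕ) (hn : 1 ≤ n) (W : ℝ → ℝ) (hW : IsDoubleWell W) :
    ∃ h : ℝ → ℝ → ℝ,
      (∀ ε : ℝ, 0 < ε →
        IsProfile n W ε (h ε) ∧ Function.Odd (h ε) ∧ StrictMono (h ε)) ∧
      (∀ ε₀ : ℝ, 0 < ε₀ → ∃ C : ℝ, 0 < C ∧ ∀ ε : ℝ, 0 < ε → ε ≤ ε₀ →
        profileEnergy n W ε (h ε) ≤ ENNReal.ofReal (C / ε)) ∧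
      TendstoLocallyUniformlyOn h Real.sign (𝓝[>] 0) ({0}ᶜ : Set ℝ) := by
  choose! h k H using fun (ε : ℝ) (hε : 0 < ε) => (hW.scaledPotential hε).exists_isKink (n - 1)
  refine ⟨h, fun ε hε => ⟨(H ε hε).isProfile hn (hW.scaledPotential hε), (H ε hε).odd,
    (H ε hε).strictMono⟩, fun ε₀ hε₀ => ?_, tendstoLocallyUniformlyOn_sign_of_isKink hW H⟩
  obtain ⟨C, hC, hCε⟩ := IsKink.exists_profileEnergy_le (n := n) hW ε₀ hε₀
  exact ⟨C, hC, fun ε hε hεε₀ => hCε ε hε hεε₀ _ _ (H ε hε)⟩
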